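/- A continuum is a non-empty compact connected metrizable space, carrying its unique compatible uniformity. Let $G$ be a group of bijections of a uniform space $Y$. For an entourage $E$ of $Y$ let $U_E(G)=\{g\in G:(y,g(y))\in E\text{ for all }y\in Y\}$, let $S_E(G)=\{g\in G:(y,g(y))\in E\text{ for some }y\in Y\}$, and let $N_E(G)$ be the subgroup generated by $S_E(G)$. The group $G$ acts isomorphically if $Y$ has a basis of entourages $E$ with $(g\times g)(E)=E$ for all $g\in G$, and prodiscretely if for every entourage $E$ there is an entourage $F$ with $N_F(G)\subset U_E(G)$. A map $f:Y\to X$ between uniform spaces is a generalized regular covering map with deck group $G$, written $f:Y\to X=Y/G$, if $G$ acts isomorphically and prodiscretely on $Y$, $G$ is complete in the uniformity of uniform convergence, and $f$ is the quotient map by $G$; that is, $f$ is surjective, uniformly continuous and maps entourages onto entourages, and $f(y)=f(y')$ if and only if $y'=g(y)$ for some $g\in G$. A map is a generalized regular covering map if it is one with some deck group. Let $X$ be a continuum with a basepoint $*$. A cover of $X$ by a continuum is a covering map $f_i:X_i\to X$ from a continuum $X_i$ that is also the quotient map of a free action of a group of homeomorphisms of $X_i$. Choose one such cover $f_i:X_i\to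 X$ from each class of covers modulo homeomorphism over $X$, and a basepoint of each $X_i$ over $*$. The compact universal cover $\widehat X$ of $X$ is the inverse limit of the spaces $X_i$, with the inverse limit uniformity, where the bonding maps are the continuous surjective basepoint-preserving maps $f_{ij}:X_j\to X_i$ with $f_j=f_i\circ f_{ij}$ (there is at most one for each pair $i,j$). Let $\widehat\phi:\widehat X\to X$ be the projection, $\widehat\phi((x_i))=f_i(x_i)$ (the same for every $i$). Theorem (Universal Property). Let $X$ and $Y$ be continua, and let $f:Y\to X=Y/G$ be a generalized regular covering map with deck group $G$. Then there is a generalized regular covering map $f_L:\widehat X\to Y$ with $\widehat\phi=f\circ f_L$. It is unique modulo $G$: the generalized regular covering maps $h:\widehat X\to Y$ with $\widehat\phi=f\circ h$ are precisely the maps $g\circ f_L$ with $g\in G$. -/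

import Mathlib

open Set Filter Topology Uniformity TopologicalSpace

/-! ## Quotients of uniform spaces by isomorphic actions

A group of bijections of `Y` is a subgroup `G` of `Equiv.Perm Y`.  All the notions below are
insensitive to whether entourages are required to be symmetric. -/

/-- A surjective uniformly continuous map which carries entourages to entourages. -/
structure BiUniformlyContinuous {Y X : Type*} [UniformSpace Y] [UniformSpace X]
    (f : Y → X) : Prop where
  uniformContinuous : UniformContinuous f
  surjective : Function.Surjective f
  image_mem : ∀ E ∈ 𝓤 Y, Prod.map f f '' E ∈ 𝓤 X

/-- `G` acts isomorphically on `Y`: the uniformity has a basis of `G`-invariant entourages. -/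
def ActsIsomorphically {Y : Type*} [UniformSpace Y] (G : Subgroup (Equiv.Perm Y)) : Prop :=
  ∀ V ∈ 𝓤 Y, ∃ E ∈ 𝓤 Y, E ⊆ V ∧ ∀ g ∈ G, Prod.map g g '' E = E

/-- `U_E(G)`: the elements of `G` that are `E`-close to the identity at all points. -/
def unifClose {Y : Type*} (G : Subgroup (Equiv.Perm Y)) (E : Set (Y × Y)) :
    Set (Equiv.Perm Y) :=
  {g | g ∈ G ∧ ∀ y, (y, g y) ∈ E}

/-- `S_E(G)`: the elements of `G` that are `E`-close to the identity at some point. -/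
def someClose {Y : Type*} (G : Subgroup (Equiv.Perm Y)) (E : Set (Y × Y)) :
    Set (Equiv.Perm Y) :=
  {g | g ∈ G ∧ ∃ y, (y, g y) ∈ E}

/-- `N_E(G)`: the subgroup generated by `S_E(G)`. -/
def closeSubgroup {Y : Type*} (G : Subgroup (Equiv.Perm Y)) (E : Set (Y × Y)) :
    Subgroup (Equiv.Perm Y) :=
  Subgroup.closure (someClose G E)

/-- `G` acts prodiscretely: every `U_E(G)` contains some `N_F(G)`. -/
def ActsProdiscretely {Y : Type*} [UniformSpace Y] (G : Subgroup (Equiv.Perm Y)) : Prop :=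
  ∀ E ∈ 𝓤 Y, ∃ F ∈ 𝓤 Y, (closeSubgroup G F : Set (Equiv.Perm Y)) ⊆ unifClose G E

/-- The uniformity of uniform convergence on `G`, with basic entourages
`{(g, h) | ∀ y, (g y, h y) ∈ E}`. -/
abbrev uniformConvergenceUniformity {Y : Type*} [UniformSpace Y]
    (G : Subgroup (Equiv.Perm Y)) : UniformSpace G :=
  UniformSpace.comap (fun g : G => UniformFun.ofFun (g : Equiv.Perm Y)) inferInstance

/-- `f : Y → X` is a generalized regular covering map with deck group `G`, i.e. (up to the
canonical identification of `X` with `Y / G` carrying the quotient uniformity) `f` is the quotient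
map of an isomorphic and prodiscrete action of the complete group `G` on `Y`. -/
structure IsGeneralizedRegularCoveringWith {Y X : Type*} [UniformSpace Y] [UniformSpace X]
    (G : Subgroup (Equiv.Perm Y)) (f : Y → X) : Prop where
  isomorphic : ActsIsomorphically G
  prodiscrete : ActsProdiscretely G
  complete : @CompleteSpace G (uniformConvergenceUniformity G)
  biUniform : BiUniformlyContinuous f
  fiber_iff : ∀ y y' : Y, f y = f y' ↔ ∃ g ∈ G, g y = y'

/-- `f` is a generalized regular covering map (with some deck group). -/
def IsGeneralizedRegularCovering {Y X : Type*} [UniformSpace Y] [UniformSpace X]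
    (f : Y → X) : Prop :=
  ∃ G : Subgroup (Equiv.Perm Y), IsGeneralizedRegularCoveringWith G f

/-! ## Traditional regular covers by continua -/

/-- A (traditional) regular covering map: a covering map that is also the quotient map of a free
action by a group of homeomorphisms. -/
def IsRegularCoveringMap {Y X : Type*} [TopologicalSpace Y] [TopologicalSpace X]
    (f : Y → X) : Prop :=
  IsCoveringMap f ∧ ∃ G : Subgroup (Y ≃ₜ Y),
    (∀ g ∈ G, ∀ y, g y = y → g = 1) ∧ IsQuotientMap f ∧
      ∀ y y' : Y, f y = f y' ↔ ∃ g ∈ G, g y = y'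

universe u v

/-- A cover of `X` by a continuum (a compact connected metrizable space): a regular covering map
onto `X` from a continuum, which carries its unique compatible uniformity. -/
structure ContinuumCover (X : Type u) [TopologicalSpace X] : Type (u + 1) where
  Total : Type u
  [uniformSpace : UniformSpace Total]
  [compactSpace : CompactSpace Total]
  [connectedSpace : ConnectedSpace Total]
  [metrizableSpace : MetrizableSpace Total]
  map : Total → X
  isRegularCoveringMap : IsRegularCoveringMap map

namespace ContinuumCover

attribute [instance] uniformSpace compactSpace connectedSpace metrizableSpace

/-- Two covers are equivalent if there is a homeomorphism between them over `X`. -/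
instance setoid (X : Type u) [TopologicalSpace X] : Setoid (ContinuumCover X) where
  r c d := ∃ h : c.Total ≃ₜ d.Total, d.map ∘ h = c.map
  iseqv :=
    { refl := fun c => ⟨Homeomorph.refl _, rfl⟩
      symm := by
        rintro c d ⟨h, hh⟩
        refine ⟨h.symm, ?_⟩
        rw [← hh]
        ext x
        simp
      trans := by
        rintro c d e ⟨h, hh⟩ ⟨k, hk⟩
        refine ⟨h.trans k, ?_⟩
        rw [← hh, ← hk]
        rfl }

/-- The identity of a continuum, as a cover. -/
def trivial (X : Type u) [UniformSpace X] [CompactSpace X] [ConnectedSpace X]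
    [MetrizableSpace X] : ContinuumCover X where
  Total := X
  map := id
  isRegularCoveringMap :=
    ⟨fun _ => IsEvenlyCovered.to_isEvenlyCovered_preimage (I := Unit)
        ⟨inferInstance, univ, mem_univ _, isOpen_univ, isOpen_univ,
          (Homeomorph.prodPUnit.{u, 0} _).symm, fun _ => rfl⟩, ⊥, by simp, IsQuotientMap.id, by simp⟩

end ContinuumCover

/-- The equivalence classes of covers of `X` by continua: the index set of the inverse system. -/
def CoverIndex (X : Type u) [TopologicalSpace X] : Type (u + 1) :=
  Quotient (ContinuumCover.setoid X)

namespace CoverIndex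

variable {X : Type u} [TopologicalSpace X]

/-- The cover `f_i : X_i → X` chosen from the equivalence class `i`. -/
noncomputable def cover (i : CoverIndex X) : ContinuumCover X := Quotient.out i

theorem exists_basepoint (x₀ : X) (i : CoverIndex X) :
    ∃ y : i.cover.Total, i.cover.map y = x₀ :=
  let ⟨_, _, _, hq, _⟩ := i.cover.isRegularCoveringMap
  hq.surjective x₀

/-- The basepoint of `X_i`, chosen over the basepoint `x₀` of `X`. -/
noncomputable def basepoint (x₀ : X) (i : CoverIndex X) : i.cover.Total :=
  (exists_basepoint x₀ i).choose

theorem map_basepoint (x₀ : X) (i : CoverIndex X) : i.cover.map (i.basepoint x₀) = x₀ :=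
  (exists_basepoint x₀ i).choose_spec

/-- `g` is a bonding map `f_ij : X_j → X_i`: a continuous, surjective, basepoint preserving map
with `f_j = f_i ∘ g`. (There is at most one, and there is one up to a change of basepoint if and
only if `f_i ≤ f_j`.) -/
structure IsBonding (x₀ : X) (i j : CoverIndex X) (g : j.cover.Total → i.cover.Total) :
    Prop where
  continuous : Continuous g
  surjective : Function.Surjective g
  comp_eq : i.cover.map ∘ g = j.cover.map
  basepoint_eq : g (j.basepoint x₀) = i.basepoint x₀

end CoverIndex

/-- The compact universal cover `X̂` of `X` (with basepoint `x₀`): the inverse limit of the covers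
of `X` by continua, as a subspace of the product. -/
def CompactUniversalCover {X : Type u} [TopologicalSpace X] (x₀ : X) : Type (u + 1) :=
  {x : ∀ i : CoverIndex X, i.cover.Total //
    ∀ i j (g : j.cover.Total → i.cover.Total), CoverIndex.IsBonding x₀ i j g → x i = g (x j)}

/-- The inverse limit uniformity on `X̂`. -/
noncomputable instance {X : Type u} [TopologicalSpace X] (x₀ : X) :
    UniformSpace (CompactUniversalCover x₀) :=
  inferInstanceAs (UniformSpace {x : ∀ i : CoverIndex X, i.cover.Total //
    ∀ i j (g : j.cover.Total → i.cover.Total), CoverIndex.IsBonding x₀ i j g → x i = g (x j)})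

namespace CompactUniversalCover

variable {X : Type u} [UniformSpace X] [CompactSpace X] [ConnectedSpace X] [MetrizableSpace X]

/-- The projection `φ̂ : X̂ → X`, through the class of the identity cover of `X`. -/
noncomputable def proj (x₀ : X) (x : CompactUniversalCover x₀) : X :=
  let i : CoverIndex X := Quotient.mk _ (ContinuumCover.trivial X)
  i.cover.map (x.1 i)

/-- The projection to `X` may be computed through any of the covers. -/
theorem map_eq_proj {x₀ : X} (x : CompactUniversalCover x₀) (i : CoverIndex X) :
    i.cover.map (x.1 i) = proj x₀ x := by
  let k : CoverIndex X := Quotient.mk _ (ContinuumCover.trivial X)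
  change _ = k.cover.map (x.1 k)
  obtain ⟨h, hh⟩ : ∃ h : k.cover.Total ≃ₜ X, (id : X → X) ∘ h = k.cover.map :=
    Quotient.exact (Quotient.out_eq k)
  have hk : ∀ y, k.cover.map y = h y := fun y => by rw [← hh]; rfl
  obtain ⟨hc, _, _, hq, _⟩ := i.cover.isRegularCoveringMap
  have hb : CoverIndex.IsBonding x₀ k i (h.symm ∘ i.cover.map) :=
    { continuous := h.symm.continuous.comp hq.continuous
      surjective := h.symm.surjective.comp hq.surjective
      comp_eq := by
        ext y
        simp [hk]
      basepoint_eq := by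
        rw [Function.comp_apply, CoverIndex.map_basepoint, Homeomorph.symm_apply_eq, ← hk,
          CoverIndex.map_basepoint] }
  rw [x.2 k i _ hb, hk]
  simp

end CompactUniversalCover

/-! ## Homogeneous maps and normal covers -/

/-! Two tools carry the proof: uniqueness of lifts through a locally injective map, and the fact
that an open map from a compact Hausdorff space to a connected Hausdorff space sends every component
onto. Openness comes from homogeneity of the fibers.

The fiber product of all covers of `X` is homogeneous over each factor, so its base component maps
onto every cover. By unique lifting that component satisfies the bonding relations; since the covers
are directed (`exists_bonding_pair`), it is dense in `X̂`. Hence it equals `X̂`, which is therefore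
connected with homogeneous fibers over `X` (`range_toFiberProduct`, `fiberHomogeneous_proj`).

If `E` is an invariant entourage, `N_E(G)` is normal in `G` and `Y / N_E(G)` is a regular cover of
`X` by a continuum (`exists_cover`). By prodiscreteness these quotients separate the points of `Y`,
so lifts through `f` are unique. A component of the fiber product of `X̂` and `Y` over `X` is onto
both factors and injective over `X̂`, hence is the graph of a lift (`exists_lift`). The
homeomorphisms of `X̂` over `Y` form the deck group of this lift
(`isGeneralizedRegularCovering_of_lift`), and unique lifting gives uniqueness modulo `G`. -/

/-- The homeomorphisms of `Z` over `X` act transitively on the fibers of `p`. -/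
def FiberHomogeneous {Z X : Type*} [TopologicalSpace Z] (p : Z → X) : Prop :=
  ∀ a b, p a = p b → ∃ h : Z ≃ₜ Z, p ∘ h = p ∧ h a = b

/-- A locally injective continuous surjection with homogeneous fibers. For continua these are the
regular covering maps. -/
structure IsNormalCover {Z X : Type*} [TopologicalSpace Z] [TopologicalSpace X]
    (p : Z → X) : Prop where
  continuous : Continuous p
  surjective : Function.Surjective p
  locallyInjective : IsLocallyInjective p
  homogeneous : FiberHomogeneous p

/-- The saturation of an open set is the union of its preimages under the homeomorphisms over `X`.
-/
theorem FiberHomogeneous.isOpenMap_of_isQuotientMap {Z X : Type*} [TopologicalSpace Z]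
    [TopologicalSpace X] {p : Z → X} (hq : IsQuotientMap p) (hp : FiberHomogeneous p) :
    IsOpenMap p := by
  intro U hU
  rw [← hq.isOpen_preimage]
  have : p ⁻¹' (p '' U) = ⋃ h : {h : Z ≃ₜ Z // p ∘ h = p}, h.1 ⁻¹' U := by
    ext z
    simp only [mem_preimage, mem_image, mem_iUnion, Subtype.exists, exists_prop]
    constructor
    · rintro ⟨a, ha, e⟩
      obtain ⟨h, h1, h2⟩ := hp z a e.symm
      exact ⟨h, h1, h2 ▸ ha⟩
    · rintro ⟨h, h1, h2⟩
      exact ⟨h z, h2, congrFun h1 z⟩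
  rw [this]
  exact isOpen_iUnion fun h => hU.preimage h.1.continuous

theorem FiberHomogeneous.isOpenMap {Z X : Type*} [TopologicalSpace Z] [TopologicalSpace X]
    [CompactSpace Z] [T2Space X] {p : Z → X} (hc : Continuous p) (hs : Function.Surjective p)
    (hp : FiberHomogeneous p) : IsOpenMap p :=
  hp.isOpenMap_of_isQuotientMap (hc.isClosedMap.isQuotientMap hc hs)

/-- A continuous open map from a compact Hausdorff space to a connected Hausdorff space maps each
component onto. -/
theorem image_connectedComponent_eq_univ {K L : Type*} [TopologicalSpace K] [TopologicalSpace L]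
    [CompactSpace K] [T2Space K] [T2Space L] [ConnectedSpace L] {q : K → L}
    (hc : Continuous q) (ho : IsOpenMap q) (k : K) : q '' connectedComponent k = univ := by
  refine eq_univ_of_forall fun l => ?_
  have hl : IsClosed (q ⁻¹' {l}) := isClosed_singleton.preimage hc
  -- The component of `k` is the intersection of its clopen neighborhoods. Each of these has clopen
  -- image, hence meets the fiber over `l`; compactness gives a common point.
  let t : {s : Set K // IsClopen s ∧ k ∈ s} → Set K := fun s => s.1 ∩ q ⁻¹' {l}
  have : Nonempty {s : Set K // IsClopen s ∧ k ∈ s} := ⟨⟨univ, isClopen_univ, mem_univ _⟩⟩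
  have hne : (⋂ s, t s).Nonempty := by
    refine IsCompact.nonempty_iInter_of_directed_nonempty_isCompact_isClosed t ?_ ?_ ?_ ?_
    · intro s r
      exact ⟨⟨s.1 ∩ r.1, s.2.1.inter r.2.1, s.2.2, r.2.2⟩,
        inter_subset_inter_left _ inter_subset_left, inter_subset_inter_left _ inter_subset_right⟩
    · rintro ⟨s, hs, hks⟩
      have : q '' s = univ := IsClopen.eq_univ
        ⟨(hs.isClosed.isCompact.image hc).isClosed, ho _ hs.isOpen⟩ ⟨q k, k, hks, rfl⟩
      obtain ⟨a, ha, hal⟩ := this.symm ▸ mem_univ l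
      exact ⟨a, ha, hal⟩
    · exact fun s => (s.2.1.isClosed.inter hl).isCompact
    · exact fun s => s.2.1.isClosed.inter hl
  obtain ⟨a, ha⟩ := hne
  rw [mem_iInter] at ha
  refine ⟨a, ?_, (ha ⟨univ, isClopen_univ, mem_univ _⟩).2⟩
  rw [connectedComponent_eq_iInter_isClopen, mem_iInter]
  exact fun s => (ha s).1

/-- On a compact space, points of a common fiber of a locally injective map are uniformly
separated. -/
theorem IsLocallyInjective.separated_mem_uniformity {Z X : Type*} [UniformSpace Z]
    [CompactSpace Z] {p : Z → X} (hp : IsLocallyInjective p) :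
    {a : Z × Z | p a.1 = p a.2 → a.1 = a.2} ∈ 𝓤 Z := by
  rw [compactSpace_uniformity, mem_iSup]
  intro z
  obtain ⟨U, hU, hz, hinj⟩ := hp z
  filter_upwards [prod_mem_nhds (hU.mem_nhds hz) (hU.mem_nhds hz)] with a ha e
  exact hinj ha.1 ha.2 e

theorem IsRegularCoveringMap.isNormalCover {Z X : Type*} [TopologicalSpace Z]
    [TopologicalSpace X] {p : Z → X} (hp : IsRegularCoveringMap p) : IsNormalCover p := by
  obtain ⟨hc, D, -, hq, hD⟩ := hp
  refine ⟨hq.continuous, hq.surjective, hc.isLocalHomeomorph.isLocallyInjective, fun a b e => ?_⟩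
  obtain ⟨g, hg, hgb⟩ := (hD a b).1 e
  exact ⟨g, funext fun z => ((hD z (g z)).2 ⟨g, hg, rfl⟩).symm, hgb⟩

namespace IsNormalCover

variable {Z X : Type*} [TopologicalSpace Z] [TopologicalSpace X] {p : Z → X}

theorem isOpenMap [CompactSpace Z] [T2Space X] (hp : IsNormalCover p) : IsOpenMap p :=
  hp.homogeneous.isOpenMap hp.continuous hp.surjective

theorem lift_unique [T2Space Z] (hp : IsNormalCover p) {T : Type*} [TopologicalSpace T]
    [PreconnectedSpace T] {a b : T → Z} (ha : Continuous a) (hb : Continuous b)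
    (hab : ∀ t, p (a t) = p (b t)) (t : T) (ht : a t = b t) : a = b :=
  (T2Space.isSeparatedMap p).eq_of_comp_eq hp.locallyInjective ha hb (funext hab) t ht

/-- Local injectivity and openness give a local homeomorphism, which compactness turns into a
covering map. The full deck group acts freely because lifts are unique. -/
theorem isRegularCoveringMap [CompactSpace Z] [T2Space Z] [PreconnectedSpace Z] [T2Space X]
    (hp : IsNormalCover p) : IsRegularCoveringMap p := by
  refine ⟨isLocalHomeomorph_iff_isCoveringMap.1 ?_, ?_⟩
  · refine isLocalHomeomorph_iff_isOpenEmbedding_restrict.2 fun z => ?_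
    obtain ⟨U, hU, hz, hinj⟩ := hp.locallyInjective z
    exact ⟨U, hU.mem_nhds hz, .of_continuous_injective_isOpenMap
      (hp.continuous.comp continuous_subtype_val) (injOn_iff_injective.1 hinj)
      (hp.isOpenMap.comp hU.isOpenMap_subtype_val)⟩
  · let D : Subgroup (Z ≃ₜ Z) :=
      { carrier := {h | ∀ z, p (h z) = p z}
        mul_mem' := fun {a b} ha hb z => (ha (b z)).trans (hb z)
        one_mem' := fun _ => rfl
        inv_mem' := fun {a} ha z => by
          have := ha (a⁻¹ z)
          rw [show a (a⁻¹ z) = z from a.apply_symm_apply z] at this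
          exact this.symm }
    refine ⟨D, fun g hg y hy => ?_, hp.continuous.isClosedMap.isQuotientMap hp.continuous
      hp.surjective, fun y y' => ⟨fun h => ?_, ?_⟩⟩
    · have := hp.lift_unique g.continuous continuous_id (fun t => hg t) y hy
      exact Homeomorph.ext fun z => congrFun this z
    · obtain ⟨g, hg, hgy⟩ := hp.homogeneous y y' h
      exact ⟨g, fun z => congrFun hg z, hgy⟩
    · rintro ⟨g, hg, rfl⟩
      exact (hg y).symm

theorem comp_homeomorph {W : Type*} [TopologicalSpace W] (hp : IsNormalCover p) (e : W ≃ₜ Z) :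
    IsNormalCover (p ∘ e) where
  continuous := hp.continuous.comp e.continuous
  surjective := hp.surjective.comp e.surjective
  locallyInjective := hp.locallyInjective.comp_right e.continuous e.injective
  homogeneous a b hab := by
    obtain ⟨h, h1, h2⟩ := hp.homogeneous (e a) (e b) hab
    refine ⟨(e.trans h).trans e.symm, funext fun w => ?_, ?_⟩
    · simpa using congrFun h1 (e w)
    · simp [h2]

end IsNormalCover

/-! ### Covers from any universe and the index set -/

theorem small_of_secondCountable (Z : Type v) [TopologicalSpace Z] [T0Space Z]
    [SecondCountableTopology Z] : Small.{u} Z := by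
  obtain ⟨B, hB, -, hb⟩ := exists_countable_basis Z
  have : Small.{u} B := by
    have := hB.to_subtype
    obtain ⟨f, hf⟩ := exists_injective_nat B
    exact small_of_injective hf
  -- A point is determined by the basic open sets that contain it.
  refine small_of_injective (β := Set (Shrink.{u} B)) (f := fun z => {b | z ∈ ((equivShrink B).symm b).1}) ?_
  intro x y hxy
  refine hb.eq_iff.2 fun s hs => ?_
  have := congrArg (fun t => equivShrink B ⟨s, hs⟩ ∈ t) hxy
  simpa using this

namespace CoverIndex

variable {X : Type u} [TopologicalSpace X]

theorem isNormalCover (i : CoverIndex X) : IsNormalCover i.cover.map :=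
  i.cover.isRegularCoveringMap.isNormalCover

/-- Every normal cover by a continuum, in any universe, is represented by an index, compatibly
with base points. -/
theorem exists_homeomorph [T2Space X] (x₀ : X) {Z : Type v} [TopologicalSpace Z] [CompactSpace Z]
    [T2Space Z] [ConnectedSpace Z] [SecondCountableTopology Z] {p : Z → X} (hp : IsNormalCover p)
    (z₀ : Z) (hz₀ : p z₀ = x₀) :
    ∃ (i : CoverIndex X) (h : Z ≃ₜ i.cover.Total),
      i.cover.map ∘ h = p ∧ h z₀ = i.basepoint x₀ := by
  have : Small.{u} Z := small_of_secondCountable Z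
  let e : Z ≃ₜ Shrink.{u} Z := Shrink.homeomorph Z
  have : CompactSpace (Shrink.{u} Z) := e.compactSpace
  have : T2Space (Shrink.{u} Z) := e.t2Space
  have : ConnectedSpace (Shrink.{u} Z) := e.surjective.connectedSpace e.continuous
  have : SecondCountableTopology (Shrink.{u} Z) := e.symm.secondCountableTopology
  have hq : IsNormalCover (p ∘ e.symm) := hp.comp_homeomorph e.symm
  let _ : UniformSpace (Shrink.{u} Z) := uniformSpaceOfCompactR1
  let c : ContinuumCover X :=
    { Total := Shrink.{u} Z
      metrizableSpace := TopologicalSpace.metrizableSpace_of_t3_secondCountable _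
      map := p ∘ e.symm
      isRegularCoveringMap := hq.isRegularCoveringMap }
  let i : CoverIndex X := Quotient.mk _ c
  obtain ⟨h, hh⟩ : ∃ h : i.cover.Total ≃ₜ Shrink.{u} Z, (p ∘ e.symm) ∘ h = i.cover.map :=
    Quotient.exact (Quotient.out_eq i)
  let k : Z ≃ₜ i.cover.Total := e.trans h.symm
  have hk : i.cover.map ∘ k = p := by
    rw [← hh]
    funext z
    simp [k]
  obtain ⟨d, hd1, hd2⟩ := i.isNormalCover.homogeneous (k z₀) (i.basepoint x₀)
    (by rw [map_basepoint, ← hz₀, ← hk]; rfl)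
  refine ⟨i, k.trans d, ?_, hd2⟩
  rw [← hk]
  funext z
  exact congrFun hd1 (k z)

end CoverIndex

theorem Homeomorph.mapsTo_connectedComponent {Z : Type*} [TopologicalSpace Z] (h : Z ≃ₜ Z)
    {b c d : Z} (hc : c ∈ connectedComponent b) (hd : d ∈ connectedComponent b) (hcd : h c = d) :
    MapsTo h (connectedComponent b) (connectedComponent b) := by
  intro z hz
  rw [connectedComponent_eq hc] at hz
  rw [connectedComponent_eq hd, ← hcd]
  exact h.continuous.image_connectedComponent_subset c ⟨z, hz, rfl⟩

theorem secondCountableTopology_of_compact_metrizable (Z : Type*) [TopologicalSpace Z]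
    [CompactSpace Z] [MetrizableSpace Z] : SecondCountableTopology Z := by
  let _ := metrizableSpaceMetric Z
  infer_instance

/-! ### The fiber product of all covers -/

/-- The fiber product over `X` of all covers of `X` by continua. -/
def CoverFiberProduct (X : Type u) [TopologicalSpace X] : Type (u + 1) :=
  {x : ∀ i : CoverIndex X, i.cover.Total // ∀ i j : CoverIndex X, i.cover.map (x i) = j.cover.map (x j)}

namespace CoverFiberProduct

section

variable {X : Type u} [TopologicalSpace X]

instance : TopologicalSpace (CoverFiberProduct X) :=
  inferInstanceAs (TopologicalSpace
    {x : ∀ i : CoverIndex X, i.cover.Total // ∀ i j : CoverIndex X, i.cover.map (x i) = j.cover.map (x j)})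

instance : T2Space (CoverFiberProduct X) :=
  inferInstanceAs (T2Space
    {x : ∀ i : CoverIndex X, i.cover.Total // ∀ i j : CoverIndex X, i.cover.map (x i) = j.cover.map (x j)})

instance [T2Space X] : CompactSpace (CoverFiberProduct X) := by
  suffices h : IsClosed {x : ∀ i : CoverIndex X, i.cover.Total |
      ∀ i j : CoverIndex X, i.cover.map (x i) = j.cover.map (x j)} from
    isCompact_iff_compactSpace.1 h.isCompact
  simp only [ofPred_forall]
  exact isClosed_iInter fun i => isClosed_iInter fun j =>
    isClosed_eq (i.isNormalCover.continuous.comp (continuous_apply i))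
      (j.isNormalCover.continuous.comp (continuous_apply j))

theorem continuous_val :
    Continuous (fun x : CoverFiberProduct X => x.1) := continuous_subtype_val

theorem continuous_eval (k : CoverIndex X) :
    Continuous (fun x : CoverFiberProduct X => x.1 k) :=
  (continuous_apply k).comp continuous_val

theorem surjective_eval (k : CoverIndex X) :
    Function.Surjective (fun x : CoverFiberProduct X => x.1 k) := by
  classical
  intro y
  have : ∀ i : CoverIndex X, ∃ z : i.cover.Total, i.cover.map z = k.cover.map y ∧
      ∀ h : k = i, h ▸ y = z := by
    intro i
    by_cases h : k = i
    · subst h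
      exact ⟨y, rfl, fun _ => rfl⟩
    · obtain ⟨z, hz⟩ := i.isNormalCover.surjective (k.cover.map y)
      exact ⟨z, hz, fun h' => absurd h' h⟩
  choose z hz hzk using this
  exact ⟨⟨z, fun i j => (hz i).trans (hz j).symm⟩, (hzk k rfl).symm⟩

/-- A family of deck transformations acts on the fiber product. -/
noncomputable def deck (g : ∀ i : CoverIndex X, i.cover.Total ≃ₜ i.cover.Total)
    (hg : ∀ i, i.cover.map ∘ g i = i.cover.map) : CoverFiberProduct X ≃ₜ CoverFiberProduct X :=
  (Homeomorph.piCongrRight g).subtype fun x => by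
    refine forall₂_congr fun i j => ?_
    change _ ↔ i.cover.map (g i (x i)) = j.cover.map (g j (x j))
    rw [show i.cover.map (g i (x i)) = i.cover.map (x i) from congrFun (hg i) _,
      show j.cover.map (g j (x j)) = j.cover.map (x j) from congrFun (hg j) _]

/-- Deck transformations can be chosen independently in each coordinate. The last clause makes the
result a homeomorphism over the `k`-th factor, as `isOpenMap_eval` needs. -/
theorem exists_deck (a b : CoverFiberProduct X) (k : CoverIndex X)
    (hk : k.cover.map (a.1 k) = k.cover.map (b.1 k)) :
    ∃ (g : ∀ i : CoverIndex X, i.cover.Total ≃ₜ i.cover.Total)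
      (hg : ∀ i, i.cover.map ∘ g i = i.cover.map), deck g hg a = b ∧
        (a.1 k = b.1 k → g k = Homeomorph.refl _) := by
  have : ∀ i : CoverIndex X, ∃ h : i.cover.Total ≃ₜ i.cover.Total,
      i.cover.map ∘ h = i.cover.map ∧ h (a.1 i) = b.1 i ∧
        (a.1 i = b.1 i → h = Homeomorph.refl _) := by
    intro i
    by_cases h : a.1 i = b.1 i
    · exact ⟨Homeomorph.refl _, rfl, h, fun _ => rfl⟩
    · obtain ⟨d, hd, hd'⟩ := i.isNormalCover.homogeneous (a.1 i) (b.1 i)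
        (by rw [a.2 i k, b.2 i k, hk])
      exact ⟨d, hd, hd', fun h' => absurd h' h⟩
  choose g hg hgab hgk using this
  exact ⟨g, hg, Subtype.ext (funext hgab), hgk k⟩

theorem isOpenMap_eval [T2Space X] (k : CoverIndex X) :
    IsOpenMap (fun x : CoverFiberProduct X => x.1 k) := by
  refine FiberHomogeneous.isOpenMap (continuous_eval k) (surjective_eval k) fun a b hab => ?_
  obtain ⟨g, hg, h1, h2⟩ := exists_deck a b k (congrArg _ hab)
  refine ⟨deck g hg, funext fun x => ?_, h1⟩
  change g k (x.1 k) = x.1 k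
  rw [h2 hab]
  rfl

/-- The base point of the fiber product. -/
noncomputable def base (x₀ : X) : CoverFiberProduct X :=
  ⟨fun i => i.basepoint x₀, fun i j => by rw [CoverIndex.map_basepoint, CoverIndex.map_basepoint]⟩

theorem image_eval_component [T2Space X] (x₀ : X) (k : CoverIndex X) :
    (fun x : CoverFiberProduct X => x.1 k) '' connectedComponent (base x₀) = univ :=
  image_connectedComponent_eq_univ (continuous_eval k) (isOpenMap_eval k) _

end

end CoverFiberProduct

/-! ### Directedness of the system of covers -/

namespace CoverIndex

variable {X : Type u} [TopologicalSpace X]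

open CoverFiberProduct

/-- The dominating cover is the image `D` in `X_i × X_j` of the base component of the fiber product.
It is homogeneous because a deck map carrying one point of the component to another preserves the
component. -/
theorem exists_bonding_pair [T2Space X] (x₀ : X) (i j : CoverIndex X) :
    ∃ k, (∃ g, IsBonding x₀ i k g) ∧ ∃ g, IsBonding x₀ j k g := by
  let C : Set (CoverFiberProduct X) := connectedComponent (base x₀)
  let q : CoverFiberProduct X → i.cover.Total × j.cover.Total := fun x => (x.1 i, x.1 j)
  have hq : Continuous q := (continuous_eval i).prodMk (continuous_eval j)
  let D : Set (i.cover.Total × j.cover.Total) := q '' C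
  have hb : q (base x₀) ∈ D := ⟨_, mem_connectedComponent, rfl⟩
  have : CompactSpace D :=
    isCompact_iff_compactSpace.1 (isClosed_connectedComponent.isCompact.image hq)
  have : ConnectedSpace D :=
    isConnected_iff_connectedSpace.1 (isConnected_connectedComponent.image q hq.continuousOn)
  have := secondCountableTopology_of_compact_metrizable i.cover.Total
  have := secondCountableTopology_of_compact_metrizable j.cover.Total
  let p : D → X := fun z => i.cover.map z.1.1
  have hpj : ∀ z : D, p z = j.cover.map z.1.2 := by
    rintro ⟨_, c, hc, rfl⟩
    exact c.2 i j
  have hp : IsNormalCover p := by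
    refine ⟨i.isNormalCover.continuous.comp (continuous_fst.comp continuous_subtype_val), ?_, ?_,
      ?_⟩
    · intro x
      obtain ⟨y, rfl⟩ := i.isNormalCover.surjective x
      obtain ⟨c, hc, rfl⟩ := (image_eval_component x₀ i).symm ▸ mem_univ y
      exact ⟨⟨q c, c, hc, rfl⟩, rfl⟩
    · intro z
      obtain ⟨U, hU, hzU, hUi⟩ := i.isNormalCover.locallyInjective z.1.1
      obtain ⟨V, hV, hzV, hVi⟩ := j.isNormalCover.locallyInjective z.1.2
      refine ⟨Subtype.val ⁻¹' (U ×ˢ V), (hU.prod hV).preimage continuous_subtype_val,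
        ⟨hzU, hzV⟩, fun a ha b hb hab => Subtype.ext (Prod.ext ?_ ?_)⟩
      · exact hUi ha.1 hb.1 hab
      · exact hVi ha.2 hb.2 (by rw [← hpj, ← hpj, hab])
    · rintro ⟨_, c, hc, rfl⟩ ⟨_, d, hd, rfl⟩ hcd
      obtain ⟨g, hg, hgc, -⟩ := exists_deck c d i hcd
      have hgd : (deck g hg).symm d = c := by rw [← hgc, Homeomorph.symm_apply_apply]
      have hmaps := (deck g hg).mapsTo_connectedComponent hc hd hgc
      have hmaps' := (deck g hg).symm.mapsTo_connectedComponent hd hc hgd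
      refine ⟨((g i).prodCongr (g j)).subtype fun z => ⟨?_, ?_⟩, funext fun z => ?_, ?_⟩
      · rintro ⟨x, hx, rfl⟩
        exact ⟨_, hmaps hx, rfl⟩
      · rintro ⟨x, hx, hxz⟩
        refine ⟨_, hmaps' hx, ((g i).prodCongr (g j)).injective ?_⟩
        rw [← hxz]
        change q (deck g hg ((deck g hg).symm x)) = q x
        rw [Homeomorph.apply_symm_apply]
      · exact congrFun (hg i) _
      · exact Subtype.ext (congrArg q hgc)
  obtain ⟨k, h, hh, hh₀⟩ := exists_homeomorph x₀ hp ⟨_, hb⟩ (i.map_basepoint x₀)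
  have hks : ∀ z, k.cover.map z = p (h.symm z) := fun z => by
    rw [← hh]
    simp
  have hk₀ : h.symm (k.basepoint x₀) = ⟨_, hb⟩ := by rw [← hh₀, Homeomorph.symm_apply_apply]
  refine ⟨k, ⟨fun z => (h.symm z).1.1, ?_, ?_, ?_, ?_⟩, ⟨fun z => (h.symm z).1.2, ?_, ?_, ?_, ?_⟩⟩
  · exact continuous_fst.comp (continuous_subtype_val.comp h.symm.continuous)
  · intro y
    obtain ⟨c, hc, rfl⟩ := (image_eval_component x₀ i).symm ▸ mem_univ y
    exact ⟨h ⟨q c, c, hc, rfl⟩, by simp [q]⟩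
  · exact funext fun z => (hks z).symm
  · simp only [hk₀]
    rfl
  · exact continuous_snd.comp (continuous_subtype_val.comp h.symm.continuous)
  · intro y
    obtain ⟨c, hc, rfl⟩ := (image_eval_component x₀ j).symm ▸ mem_univ y
    exact ⟨h ⟨q c, c, hc, rfl⟩, by simp [q]⟩
  · exact funext fun z => ((hks z).trans (hpj _)).symm
  · simp only [hk₀]
    rfl

theorem IsBonding.comp {x₀ : X} {i j k : CoverIndex X} {g : j.cover.Total → i.cover.Total}
    {h : k.cover.Total → j.cover.Total} (hg : IsBonding x₀ i j g) (hh : IsBonding x₀ j k h) :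
    IsBonding x₀ i k (g ∘ h) where
  continuous := hg.continuous.comp hh.continuous
  surjective := hg.surjective.comp hh.surjective
  comp_eq := by rw [← Function.comp_assoc, hg.comp_eq, hh.comp_eq]
  basepoint_eq := by rw [Function.comp_apply, hh.basepoint_eq, hg.basepoint_eq]

theorem exists_bonding_finset [T2Space X] [Nonempty (CoverIndex X)] (x₀ : X)
    (s : Finset (CoverIndex X)) : ∃ k, ∀ i ∈ s, ∃ g, IsBonding x₀ i k g := by
  classical
  induction s using Finset.induction_on with
  | empty => exact ⟨Classical.arbitrary _, by simp⟩
  | insert a s _ ih =>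
    obtain ⟨k, hk⟩ := ih
    obtain ⟨l, ⟨g, hg⟩, g', hg'⟩ := exists_bonding_pair x₀ a k
    refine ⟨l, fun i hi => ?_⟩
    rcases Finset.mem_insert.1 hi with rfl | hi
    · exact ⟨g, hg⟩
    · obtain ⟨r, hr⟩ := hk i hi
      exact ⟨_, hr.comp hg'⟩

end CoverIndex

/-! ### The compact universal cover as a component of the fiber product -/

namespace CompactUniversalCover

open CoverFiberProduct

section

variable {X : Type u} [TopologicalSpace X] {x₀ : X}

theorem uniformContinuous_val :
    UniformContinuous (fun x : CompactUniversalCover x₀ => x.1) := uniformContinuous_subtype_val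

theorem continuous_eval (i : CoverIndex X) :
    Continuous (fun x : CompactUniversalCover x₀ => x.1 i) :=
  (continuous_apply i).comp uniformContinuous_val.continuous

end

variable {X : Type u} [UniformSpace X] [CompactSpace X] [ConnectedSpace X] [MetrizableSpace X]
  {x₀ : X}

instance : T2Space (CompactUniversalCover x₀) :=
  inferInstanceAs (T2Space {x : ∀ i : CoverIndex X, i.cover.Total //
    ∀ i j (g : j.cover.Total → i.cover.Total), CoverIndex.IsBonding x₀ i j g → x i = g (x j)})

instance : CompactSpace (CompactUniversalCover x₀) := by
  suffices h : IsClosed {x : ∀ i : CoverIndex X, i.cover.Total |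
      ∀ i j (g : j.cover.Total → i.cover.Total),
        CoverIndex.IsBonding x₀ i j g → x i = g (x j)} from
    isCompact_iff_compactSpace.1 h.isCompact
  simp only [ofPred_forall]
  exact isClosed_iInter fun i => isClosed_iInter fun j => isClosed_iInter fun g =>
    isClosed_iInter fun hg => isClosed_eq (continuous_apply i)
      (hg.continuous.comp (continuous_apply j))

/-- The inverse limit, inside of the fiber product. -/
def toFiberProduct (x : CompactUniversalCover x₀) : CoverFiberProduct X :=
  ⟨x.1, fun i j => by rw [map_eq_proj, map_eq_proj]⟩

theorem isInducing_toFiberProduct :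
    IsInducing (toFiberProduct : CompactUniversalCover x₀ → CoverFiberProduct X) :=
  .of_comp (IsInducing.subtypeVal.continuous.subtype_mk _) CoverFiberProduct.continuous_val
    IsInducing.subtypeVal

/-- On the component, `c ↦ c i` and `c ↦ g (c j)` lift the same map to `X` and agree at the base
point. -/
theorem exists_toFiberProduct_eq {c : CoverFiberProduct X}
    (hc : c ∈ connectedComponent (base x₀)) :
    ∃ x : CompactUniversalCover x₀, toFiberProduct x = c := by
  refine ⟨⟨c.1, fun i j g hg => ?_⟩, rfl⟩
  have : PreconnectedSpace (connectedComponent (base x₀)) :=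
    isPreconnected_iff_preconnectedSpace.1 isPreconnected_connectedComponent
  have := i.isNormalCover.lift_unique
    (a := fun c : connectedComponent (base x₀) => c.1.1 i)
    (b := fun c : connectedComponent (base x₀) => g (c.1.1 j))
    ((CoverFiberProduct.continuous_eval i).comp continuous_subtype_val)
    (hg.continuous.comp ((CoverFiberProduct.continuous_eval j).comp continuous_subtype_val))
    (fun t => (t.1.2 i j).trans (congrFun hg.comp_eq _).symm) ⟨_, mem_connectedComponent⟩
    hg.basepoint_eq.symm
  exact congrFun this ⟨c, hc⟩

instance : Nonempty (CoverIndex X) := ⟨Quotient.mk _ (ContinuumCover.trivial X)⟩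

/-- A basic neighborhood of `x` restricts finitely many coordinates, all determined by a single
`X_k`. The component maps onto `X_k`, so it contains a point with the same `k`-th coordinate as `x`.
-/
theorem toFiberProduct_mem (x : CompactUniversalCover x₀) :
    toFiberProduct x ∈ connectedComponent (base x₀) := by
  rw [← isClosed_connectedComponent.closure_eq, mem_closure_iff]
  intro O hO hx
  obtain ⟨W, hW, rfl⟩ := isOpen_induced_iff.1 hO
  obtain ⟨s, U, hU, hUW⟩ := isOpen_pi_iff.1 hW _ hx
  obtain ⟨k, hk⟩ := CoverIndex.exists_bonding_finset x₀ s
  obtain ⟨c, hc, hck⟩ := (image_eval_component x₀ k).symm ▸ mem_univ (x.1 k)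
  refine ⟨c, hUW fun i hi => ?_, hc⟩
  obtain ⟨y, rfl⟩ := exists_toFiberProduct_eq hc
  obtain ⟨g, hg⟩ := hk i hi
  have h1 : y.1 i = x.1 i := by
    rw [y.2 i k g hg, x.2 i k g hg]
    exact congrArg g hck
  exact h1.symm ▸ (hU i hi).2

theorem range_toFiberProduct :
    range (toFiberProduct : CompactUniversalCover x₀ → _) = connectedComponent (base x₀) :=
  Subset.antisymm (range_subset_iff.2 toFiberProduct_mem) fun _ hc => exists_toFiberProduct_eq hc

instance : ConnectedSpace (CompactUniversalCover x₀) where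
  isPreconnected_univ := by
    rw [← isInducing_toFiberProduct.isPreconnected_image, image_univ, range_toFiberProduct]
    exact isPreconnected_connectedComponent
  toNonempty := (exists_toFiberProduct_eq (mem_connectedComponent (x := base x₀))).nonempty

theorem continuous_proj : Continuous (proj x₀) :=
  (CoverIndex.isNormalCover _).continuous.comp (continuous_eval _)

theorem surjective_proj : Function.Surjective (proj x₀) := by
  intro x
  let k : CoverIndex X := Classical.arbitrary _
  obtain ⟨y, rfl⟩ := k.isNormalCover.surjective x
  obtain ⟨c, hc, rfl⟩ := (image_eval_component x₀ k).symm ▸ mem_univ y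
  obtain ⟨z, rfl⟩ := exists_toFiberProduct_eq hc
  exact ⟨z, (map_eq_proj z k).symm⟩

/-- Maps to `X̂` over `X` whose `i`-th coordinates agree at one point have equal `i`-th
coordinates. -/
theorem eval_lift_unique {T : Type*} [TopologicalSpace T] [PreconnectedSpace T]
    {a b : T → CompactUniversalCover x₀} (i : CoverIndex X)
    (ha : Continuous fun t => (a t).1 i) (hb : Continuous fun t => (b t).1 i)
    (hab : ∀ t, proj x₀ (a t) = proj x₀ (b t)) (t : T) (ht : (a t).1 i = (b t).1 i) (s : T) :
    (a s).1 i = (b s).1 i :=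
  congrFun (i.isNormalCover.lift_unique ha hb
    (fun t => by rw [map_eq_proj, map_eq_proj, hab]) t ht) s

theorem fiberHomogeneous_proj : FiberHomogeneous (proj x₀) := by
  intro a b hab
  let k : CoverIndex X := Classical.arbitrary _
  obtain ⟨g, hg, h1, -⟩ := exists_deck (toFiberProduct a) (toFiberProduct b) k
    ((map_eq_proj a k).trans (hab.trans (map_eq_proj b k).symm))
  have h2 : (deck g hg).symm (toFiberProduct b) = toFiberProduct a := by
    rw [← h1, Homeomorph.symm_apply_apply]
  have hm := (deck g hg).mapsTo_connectedComponent (toFiberProduct_mem a) (toFiberProduct_mem b) h1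
  have hm' := (deck g hg).symm.mapsTo_connectedComponent (toFiberProduct_mem b)
    (toFiberProduct_mem a) h2
  choose F hF using fun x : CompactUniversalCover x₀ =>
    exists_toFiberProduct_eq (hm (toFiberProduct_mem x))
  choose F' hF' using fun x : CompactUniversalCover x₀ =>
    exists_toFiberProduct_eq (hm' (toFiberProduct_mem x))
  have inj : Function.Injective (toFiberProduct : CompactUniversalCover x₀ → _) :=
    fun x y h => Subtype.ext (congrArg (fun c : CoverFiberProduct X => c.1) h)
  have hcont : Continuous (toFiberProduct : CompactUniversalCover x₀ → _) :=
    isInducing_toFiberProduct.continuous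
  refine ⟨⟨⟨F, F', fun x => inj ?_, fun x => inj ?_⟩, ?_, ?_⟩, funext fun x => ?_, inj ?_⟩
  · rw [hF', hF, Homeomorph.symm_apply_apply]
  · rw [hF, hF', Homeomorph.apply_symm_apply]
  · exact isInducing_toFiberProduct.continuous_iff.2
      (((deck g hg).continuous.comp hcont).congr fun x => (hF x).symm)
  · exact isInducing_toFiberProduct.continuous_iff.2
      (((deck g hg).symm.continuous.comp hcont).congr fun x => (hF' x).symm)
  · change proj x₀ (F x) = proj x₀ x
    rw [← map_eq_proj (F x) k, ← map_eq_proj x k,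
      show (F x).1 k = g k (x.1 k) from congrArg (fun c : CoverFiberProduct X => c.1 k) (hF x)]
    exact congrFun (hg k) _
  · exact (hF a).trans h1

end CompactUniversalCover

/-! ### Isomorphic and prodiscrete actions, and the quotients by `N_E(G)` -/

section UniformActions

variable {Y : Type v} {G : Subgroup (Equiv.Perm Y)}

theorem perm_inv_apply_self (g : Equiv.Perm Y) (y : Y) : g⁻¹ (g y) = y := g.symm_apply_apply y

theorem perm_apply_inv_self (g : Equiv.Perm Y) (y : Y) : g (g⁻¹ y) = y := g.apply_symm_apply y

theorem mem_of_image_prodMap_eq {g : Equiv.Perm Y} {E : Set (Y × Y)}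
    (h : Prod.map g g '' E = E) {a b : Y} : (g a, g b) ∈ E ↔ (a, b) ∈ E := by
  constructor
  · intro hab
    rw [← h] at hab
    obtain ⟨⟨c, d⟩, hcd, e⟩ := hab
    rw [Prod.map_apply, Prod.mk.injEq, g.injective.eq_iff, g.injective.eq_iff] at e
    rwa [← e.1, ← e.2]
  · intro hab
    rw [← h]
    exact ⟨(a, b), hab, rfl⟩

theorem closeSubgroup_mono {E F : Set (Y × Y)} (h : E ⊆ F) :
    closeSubgroup G E ≤ closeSubgroup G F :=
  Subgroup.closure_mono fun _ hg => ⟨hg.1, hg.2.imp fun _ hy => h hy⟩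

theorem closeSubgroup_le (E : Set (Y × Y)) : closeSubgroup G E ≤ G :=
  (Subgroup.closure_le _).2 fun _ hg => hg.1

theorem mem_closeSubgroup {E : Set (Y × Y)} {g : Equiv.Perm Y} (hg : g ∈ G) {y : Y}
    (h : (y, g y) ∈ E) : g ∈ closeSubgroup G E :=
  Subgroup.subset_closure ⟨hg, y, h⟩

/-- If `s` moves `y` to an `E`-close point, its conjugate by `g` does the same at `g y`. Normality
lets `G` act on `Y / N_E(G)`. -/
theorem conj_mem_closeSubgroup {E : Set (Y × Y)} (hE : ∀ g ∈ G, Prod.map g g '' E = E)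
    {g n : Equiv.Perm Y} (hg : g ∈ G) (hn : n ∈ closeSubgroup G E) :
    g * n * g⁻¹ ∈ closeSubgroup G E := by
  have : closeSubgroup G E ≤ (closeSubgroup G E).comap (MulAut.conj g).toMonoidHom := by
    refine (Subgroup.closure_le _).2 ?_
    rintro s ⟨hs, y, hy⟩
    refine mem_closeSubgroup (y := g y) (G.mul_mem (G.mul_mem hg hs) (G.inv_mem hg)) ?_
    change (g y, g (s (g⁻¹ (g y)))) ∈ E
    rw [perm_inv_apply_self, mem_of_image_prodMap_eq (hE g hg)]
    exact hy
  exact this hn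

variable [UniformSpace Y]

theorem ActsIsomorphically.uniformContinuous (hG : ActsIsomorphically G) {g : Equiv.Perm Y}
    (hg : g ∈ G) : UniformContinuous g := by
  intro V hV
  obtain ⟨E, hE, hEV, hinv⟩ := hG V hV
  refine mem_map.2 (mem_of_superset hE fun a ha => ?_)
  exact hEV ((mem_of_image_prodMap_eq (hinv g hg) (a := a.1) (b := a.2)).2 ha)

/-- The elements of an isomorphically acting group, as homeomorphisms. -/
def ActsIsomorphically.homeomorph (hG : ActsIsomorphically G) {g : Equiv.Perm Y}
    (hg : g ∈ G) : Y ≃ₜ Y where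
  toEquiv := g
  continuous_toFun := (hG.uniformContinuous hg).continuous
  continuous_invFun := (hG.uniformContinuous (G.inv_mem hg)).continuous

/-- This is how prodiscreteness enters: the orbits of the groups `N_F(G)` separate points. -/
theorem ActsProdiscretely.eq_of_forall [T0Space Y] (hG : ActsProdiscretely G) {y y' : Y}
    (h : ∀ F ∈ 𝓤 Y, ∃ n ∈ closeSubgroup G F, n y = y') : y = y' := by
  refine eq_of_uniformity fun {E} hE => ?_
  obtain ⟨F, hF, hFE⟩ := hG E hE
  obtain ⟨n, hn, rfl⟩ := h F hF
  exact (hFE hn).2 y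

end UniformActions

namespace IsGeneralizedRegularCoveringWith

variable {X : Type u} [UniformSpace X] {Y : Type v} [UniformSpace Y]
  {G : Subgroup (Equiv.Perm Y)} {f : Y → X}

theorem continuous (hf : IsGeneralizedRegularCoveringWith G f) : Continuous f :=
  hf.biUniform.uniformContinuous.continuous

theorem map_apply (hf : IsGeneralizedRegularCoveringWith G f) {g : Equiv.Perm Y} (hg : g ∈ G)
    (y : Y) : f (g y) = f y :=
  ((hf.fiber_iff y (g y)).2 ⟨g, hg, rfl⟩).symm

theorem fiberHomogeneous (hf : IsGeneralizedRegularCoveringWith G f) : FiberHomogeneous f := by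
  intro a b hab
  obtain ⟨g, hg, hgb⟩ := (hf.fiber_iff a b).1 hab
  exact ⟨hf.isomorphic.homeomorph hg, funext fun y => hf.map_apply hg y, hgb⟩

variable [T2Space X] [CompactSpace Y] [ConnectedSpace Y] [MetrizableSpace Y]

/-- A generalized regular covering map of continua factors through covers whose fibers are the
orbits of the groups `N_F(G)`. -/
theorem exists_cover (hf : IsGeneralizedRegularCoveringWith G f) (x₀ : X) (y₀ : Y)
    (hy₀ : f y₀ = x₀) {F : Set (Y × Y)} (hF : F ∈ 𝓤 Y) :
    ∃ (i : CoverIndex X) (q : Y → i.cover.Total), Continuous q ∧ i.cover.map ∘ q = f ∧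
      q y₀ = i.basepoint x₀ ∧
      ∀ y y', q y = q y' → ∃ n ∈ closeSubgroup G F, n y = y' := by
  obtain ⟨E, hE, hEF, hinv⟩ := hf.isomorphic F hF
  obtain ⟨V, hV, hVs, hVE⟩ := comp_symm_mem_uniformity_sets hE
  obtain ⟨W, hW, hWV, hWinv⟩ := hf.isomorphic V hV
  have hcomp : ∀ {a b c : Y}, (b, a) ∈ V → (b, c) ∈ V → (a, c) ∈ E := fun {a b c} h1 h2 =>
    hVE (SetRel.prodMk_mem_comp (hVs.symm _ _ h1) h2)
  let N := closeSubgroup G E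
  have hNG : N ≤ G := closeSubgroup_le E
  let s : Setoid Y :=
    { r := fun y y' => ∃ n ∈ N, n y = y'
      iseqv :=
        { refl := fun y => ⟨1, N.one_mem, rfl⟩
          symm := by
            rintro y _ ⟨n, hn, rfl⟩
            exact ⟨n⁻¹, N.inv_mem hn, perm_inv_apply_self n y⟩
          trans := by
            rintro y _ _ ⟨n, hn, rfl⟩ ⟨m, hm, rfl⟩
            exact ⟨m * n, N.mul_mem hm hn, rfl⟩ } }
  let π : Y → Quotient s := Quotient.mk s
  have hπ : IsQuotientMap π := isQuotientMap_quotient_mk'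
  have hπeq : ∀ {y y'}, π y = π y' ↔ ∃ n ∈ N, n y = y' := Quotient.eq
  have hπN : ∀ {n}, n ∈ N → ∀ y, π (n y) = π y := fun {n} hn y => (hπeq.2 ⟨n, hn, rfl⟩).symm
  have hhom : FiberHomogeneous π := by
    intro a b hab
    obtain ⟨n, hn, hnb⟩ := hπeq.1 hab
    exact ⟨hf.isomorphic.homeomorph (hNG hn), funext fun y => hπN hn y, hnb⟩
  have ho : IsOpenMap π := hhom.isOpenMap_of_isQuotientMap hπ
  -- The orbit relation of `N` is closed. Points in different fibers are separated by `f`. If `a` is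
  -- near `y` and `n a` is near `g y`, then `g⁻¹ n` moves `a` to an `E`-close point, so it lies in
  -- `N`, and hence so does `g`.
  have hT2 : T2Space (Quotient s) := by
    rw [t2Space_iff_of_isOpenQuotientMap ⟨hπ.surjective, hπ.continuous, ho⟩, ← isOpen_compl_iff,
      isOpen_iff_mem_nhds]
    rintro ⟨y, y'⟩ hyy
    by_cases h : f y = f y'
    · obtain ⟨g, hg, rfl⟩ := (hf.fiber_iff y y').1 h
      filter_upwards [prod_mem_nhds (UniformSpace.ball_mem_nhds y hW)
        (UniformSpace.ball_mem_nhds (g y) hW)]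
      rintro ⟨a, b⟩ ⟨ha, hb⟩ hab
      obtain ⟨n, hn, rfl⟩ : ∃ n ∈ N, n a = b := hπeq.1 hab
      have hb' : (y, g⁻¹ (n a)) ∈ W := by
        rw [← mem_of_image_prodMap_eq (hWinv g hg), perm_apply_inv_self]
        exact hb
      have h1 : g⁻¹ * n ∈ N :=
        mem_closeSubgroup (G.mul_mem (G.inv_mem hg) (hNG hn)) (hcomp (hWV ha) (hWV hb'))
      have h2 : g ∈ N := by
        have := N.mul_mem hn (N.inv_mem h1)
        rwa [mul_inv_rev, inv_inv, mul_inv_cancel_left] at this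
      exact hyy (hπeq.2 ⟨g, h2, rfl⟩)
    · filter_upwards [(isOpen_ne_fun (hf.continuous.comp continuous_fst)
        (hf.continuous.comp continuous_snd)).mem_nhds h]
      rintro ⟨a, b⟩ hab hab'
      obtain ⟨n, hn, rfl⟩ : ∃ n ∈ N, n a = b := hπeq.1 hab'
      exact hab (hf.map_apply (hNG hn) a).symm
  have := secondCountableTopology_of_compact_metrizable Y
  have : SecondCountableTopology (Quotient s) := hπ.secondCountableTopology ho
  let p : Quotient s → X := Quotient.lift f (by
    rintro y _ ⟨n, hn, rfl⟩
    exact (hf.map_apply (hNG hn) y).symm)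
  have hp : IsNormalCover p := by
    refine ⟨hf.continuous.quotient_lift _, fun x => ?_, ?_, ?_⟩
    · obtain ⟨y, rfl⟩ := hf.biUniform.surjective x
      exact ⟨π y, rfl⟩
    · rw [isLocallyInjective_iff_nhds]
      intro z
      obtain ⟨y, rfl⟩ := hπ.surjective z
      -- Two points of this ball in one fiber of `f` differ by an element of `S_E(G)`, so `π`
      -- identifies them.
      refine ⟨π '' UniformSpace.ball y V, ho.image_mem_nhds (UniformSpace.ball_mem_nhds y hV), ?_⟩
      rintro _ ⟨a, ha, rfl⟩ _ ⟨b, hb, rfl⟩ hab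
      obtain ⟨g, hg, rfl⟩ := (hf.fiber_iff a b).1 hab
      exact hπeq.2 ⟨g, mem_closeSubgroup hg (hcomp ha hb), rfl⟩
    · intro a b hab
      obtain ⟨a, rfl⟩ := hπ.surjective a
      obtain ⟨b, rfl⟩ := hπ.surjective b
      obtain ⟨g, hg, rfl⟩ := (hf.fiber_iff a b).1 hab
      have hmap : ∀ {g}, g ∈ G → ∀ y y', s.r y y' → s.r (g y) (g y') := by
        rintro g hg y _ ⟨n, hn, rfl⟩
        exact ⟨_, conj_mem_closeSubgroup hinv hg hn, by simp⟩
      refine ⟨⟨⟨Quotient.map g (hmap hg), Quotient.map (g⁻¹ : Equiv.Perm Y) (hmap (G.inv_mem hg)), ?_, ?_⟩,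
        (hf.isomorphic.uniformContinuous hg).continuous.quotient_map' (hmap hg),
        (hf.isomorphic.uniformContinuous (G.inv_mem hg)).continuous.quotient_map'
          (hmap (G.inv_mem hg))⟩, ?_, rfl⟩
      · rintro ⟨y⟩
        exact congrArg π (perm_inv_apply_self g y)
      · rintro ⟨y⟩
        exact congrArg π (perm_apply_inv_self g y)
      · funext z
        obtain ⟨y, rfl⟩ := hπ.surjective z
        exact hf.map_apply hg y
  obtain ⟨i, h, hh, hh₀⟩ := CoverIndex.exists_homeomorph x₀ hp (π y₀) hy₀
  refine ⟨i, h ∘ π, h.continuous.comp hπ.continuous, ?_, hh₀, fun y y' hyy => ?_⟩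
  · rw [← Function.comp_assoc, hh]
    rfl
  · obtain ⟨n, hn, hny⟩ := hπeq.1 (h.injective hyy)
    exact ⟨n, closeSubgroup_mono hEF hn, hny⟩

/-- `f` need not be locally injective, so lifts are compared in each intermediate cover and the
points of `Y` are then separated by `eq_of_forall`. -/
theorem lift_unique (hf : IsGeneralizedRegularCoveringWith G f) {T : Type*} [TopologicalSpace T]
    [PreconnectedSpace T] {a b : T → Y} (ha : Continuous a) (hb : Continuous b)
    (hab : ∀ t, f (a t) = f (b t)) (t : T) (ht : a t = b t) : a = b := by
  funext s
  refine hf.prodiscrete.eq_of_forall fun F hF => ?_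
  obtain ⟨i, q, hq, hqf, -, hqF⟩ := hf.exists_cover _ (a t) rfl hF
  refine hqF _ _ (congrFun (i.isNormalCover.lift_unique (hq.comp ha) (hq.comp hb) (fun r => ?_) t
    (congrArg q ht)) s)
  simpa [← hqf] using hab r

end IsGeneralizedRegularCoveringWith

/-! ### Finite deck groups and the entourages of `X̂` -/

theorem ContinuumCover.finite_deck {X : Type u} [TopologicalSpace X] [T1Space X]
    (c : ContinuumCover X) : {d : c.Total ≃ₜ c.Total | c.map ∘ d = c.map}.Finite := by
  obtain ⟨z⟩ : Nonempty c.Total := inferInstance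
  have hc := c.isRegularCoveringMap.isNormalCover
  have hfib : (c.map ⁻¹' {c.map z}).Finite :=
    (isClosed_singleton.preimage hc.continuous).isCompact.finite
      (isDiscrete_iff_discreteTopology.2
        (c.isRegularCoveringMap.1 (c.map z)).discreteTopology_fiber)
  -- A deck transformation is determined by its value at `z`, which lies in a finite fiber.
  refine Set.Finite.of_finite_image (f := fun d => d z)
    (hfib.subset (image_subset_iff.2 fun d hd => congrFun hd z)) fun d hd e he hde => ?_
  exact DFunLike.coe_injective (hc.lift_unique d.continuous e.continuous
    (fun t => (congrFun hd t).trans (congrFun he t).symm) z hde)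

namespace CompactUniversalCover

theorem eval_mem_uniformity {X : Type u} [UniformSpace X] {x₀ : X}
    (k : CoverIndex X) {V : Set (k.cover.Total × k.cover.Total)}
    (hV : V ∈ 𝓤 k.cover.Total) :
    {a : CompactUniversalCover x₀ × CompactUniversalCover x₀ | (a.1.1 k, a.2.1 k) ∈ V} ∈
      𝓤 (CompactUniversalCover x₀) :=
  ((Pi.uniformContinuous_proj _ k).comp uniformContinuous_val) hV

variable {X : Type u} [UniformSpace X] [CompactSpace X] [ConnectedSpace X] [MetrizableSpace X]
  {x₀ : X}

/-- Every entourage of `X̂` contains one that comes from a single cover. -/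
theorem exists_eval_subset {E : Set (CompactUniversalCover x₀ × CompactUniversalCover x₀)}
    (hE : E ∈ 𝓤 (CompactUniversalCover x₀)) :
    ∃ (k : CoverIndex X), ∃ V ∈ 𝓤 k.cover.Total,
      {a : CompactUniversalCover x₀ × CompactUniversalCover x₀ | (a.1.1 k, a.2.1 k) ∈ V} ⊆ E := by
  let ℱ : CoverIndex X → Filter (CompactUniversalCover x₀ × CompactUniversalCover x₀) :=
    fun i => comap (fun a => (a.1.1 i, a.2.1 i)) (𝓤 i.cover.Total)
  have hU : 𝓤 (CompactUniversalCover x₀) = ⨅ i, ℱ i := by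
    change comap (fun a : CompactUniversalCover x₀ × CompactUniversalCover x₀ => (a.1.1, a.2.1))
      (𝓤 (∀ i : CoverIndex X, i.cover.Total)) = _
    rw [Pi.uniformity, comap_iInf]
    simp only [comap_comap]
    rfl
  have hle : ∀ {i k : CoverIndex X}, (∃ g, CoverIndex.IsBonding x₀ i k g) → ℱ k ≤ ℱ i := by
    rintro i k ⟨g, hg⟩ _ ⟨V, hV, hVE⟩
    refine ⟨_, CompactSpace.uniformContinuous_of_continuous hg.continuous hV, fun a ha => hVE ?_⟩
    change (a.1.1 i, a.2.1 i) ∈ V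
    rw [a.1.2 i k g hg, a.2.2 i k g hg]
    exact ha
  have hdir : Directed (· ≥ ·) ℱ := by
    intro i j
    obtain ⟨k, hi, hj⟩ := CoverIndex.exists_bonding_pair x₀ i j
    exact ⟨k, hle hi, hle hj⟩
  rw [hU, mem_iInf_of_directed hdir] at hE
  obtain ⟨k, V, hV, hVE⟩ := hE
  exact ⟨k, V, hV, hVE⟩

theorem exists_base (x₀ : X) :
    ∃ b : CompactUniversalCover x₀, (∀ i, b.1 i = i.basepoint x₀) ∧ proj x₀ b = x₀ := by
  obtain ⟨b, hb⟩ := exists_toFiberProduct_eq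
    (mem_connectedComponent (x := CoverFiberProduct.base x₀))
  have h : ∀ i, b.1 i = i.basepoint x₀ := fun i =>
    congrArg (fun c : CoverFiberProduct X => c.1 i) hb
  let k : CoverIndex X := Classical.arbitrary _
  exact ⟨b, h, by rw [← map_eq_proj b k, h, CoverIndex.map_basepoint]⟩

end CompactUniversalCover

/-! ### The lift and its deck group -/

namespace IsGeneralizedRegularCoveringWith

open CompactUniversalCover

variable {X : Type u} [UniformSpace X] [CompactSpace X] [ConnectedSpace X] [MetrizableSpace X]
  {x₀ : X} {Y : Type v} [UniformSpace Y] [CompactSpace Y] [ConnectedSpace Y] [MetrizableSpace Y]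
  {G : Subgroup (Equiv.Perm Y)} {f : Y → X}

/-- The lift is the inverse limit of the projections to covers; its graph is a component of the
fiber product of `X̂` and `Y` over `X`. -/
theorem exists_lift (hf : IsGeneralizedRegularCoveringWith G f) (x₀ : X) :
    ∃ h : CompactUniversalCover x₀ → Y, Continuous h ∧ Function.Surjective h ∧
      ∀ x, f (h x) = proj x₀ x := by
  let K := {z : CompactUniversalCover x₀ × Y // proj x₀ z.1 = f z.2}
  have hK : CompactSpace K := isCompact_iff_compactSpace.1
    (isClosed_eq (continuous_proj.comp continuous_fst)
      (hf.continuous.comp continuous_snd)).isCompact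
  let p : K → CompactUniversalCover x₀ := fun z => z.1.1
  let r : K → Y := fun z => z.1.2
  have hp : Continuous p := continuous_fst.comp continuous_subtype_val
  have hr : Continuous r := continuous_snd.comp continuous_subtype_val
  have hpo : IsOpenMap p := by
    refine FiberHomogeneous.isOpenMap hp (fun x => ?_) fun a b hab => ?_
    · obtain ⟨y, hy⟩ := hf.biUniform.surjective (proj x₀ x)
      exact ⟨⟨(x, y), hy.symm⟩, rfl⟩
    · obtain ⟨h, h1, h2⟩ := hf.fiberHomogeneous a.1.2 b.1.2
        (by rw [← a.2, ← b.2]; exact congrArg _ hab)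
      refine ⟨((Homeomorph.refl _).prodCongr h).subtype fun z => ?_, rfl, ?_⟩
      · change _ ↔ _ = f (h z.2)
        rw [show f (h z.2) = f z.2 from congrFun h1 _]
        rfl
      · exact Subtype.ext (Prod.ext hab h2)
  have hro : IsOpenMap r := by
    refine FiberHomogeneous.isOpenMap hr (fun y => ?_) fun a b hab => ?_
    · obtain ⟨x, hx⟩ := surjective_proj (x₀ := x₀) (f y)
      exact ⟨⟨(x, y), hx⟩, rfl⟩
    · obtain ⟨h, h1, h2⟩ := fiberHomogeneous_proj a.1.1 b.1.1
        (by rw [a.2, b.2]; exact congrArg f hab)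
      refine ⟨(h.prodCongr (Homeomorph.refl _)).subtype fun z => ?_, rfl, ?_⟩
      · change _ ↔ proj x₀ (h z.1) = _
        rw [show proj x₀ (h z.1) = proj x₀ z.1 from congrFun h1 _]
        rfl
      · exact Subtype.ext (Prod.ext h2 hab)
  obtain ⟨b, hb, hb₀⟩ := exists_base x₀
  obtain ⟨y₀, hy₀⟩ := hf.biUniform.surjective x₀
  let k : K := ⟨(b, y₀), hb₀.trans hy₀.symm⟩
  let C : Set K := connectedComponent k
  have : CompactSpace C := isCompact_iff_compactSpace.1 isClosed_connectedComponent.isCompact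
  have : PreconnectedSpace C :=
    isPreconnected_iff_preconnectedSpace.1 isPreconnected_connectedComponent
  have hpC : p '' C = univ := image_connectedComponent_eq_univ hp hpo k
  have hrC : r '' C = univ := image_connectedComponent_eq_univ hr hro k
  let pC : C → CompactUniversalCover x₀ := fun z => p z.1
  have hpCc : Continuous pC := hp.comp continuous_subtype_val
  have hbij : Function.Bijective pC := by
    constructor
    · intro z w hzw
      refine Subtype.ext (Subtype.ext (Prod.ext hzw ?_))
      refine hf.prodiscrete.eq_of_forall fun F hF => ?_
      obtain ⟨i, q, hq, hqf, hq₀, hqF⟩ := hf.exists_cover x₀ y₀ hy₀ hF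
      -- On the component `C`, the image of the `Y`-coordinate in `X_i` and the `i`-th coordinate of
      -- `X̂` are lifts of one map to `X` that agree at `k`. So `pC z` determines `q z.1.1.2` for
      -- every `F`.
      have key : (fun z : C => q z.1.1.2) = fun z : C => (pC z).1 i := by
        refine i.isNormalCover.lift_unique (hq.comp (hr.comp continuous_subtype_val))
          ((CompactUniversalCover.continuous_eval i).comp hpCc) (fun t => ?_)
          ⟨k, mem_connectedComponent⟩ (hq₀.trans (hb i).symm)
        rw [map_eq_proj]
        exact (congrFun hqf _).trans t.1.2.symm
      refine hqF _ _ ((congrFun key z).trans (Eq.trans ?_ (congrFun key w).symm))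
      exact congrArg (fun x : CompactUniversalCover x₀ => x.1 i) hzw
    · intro x
      obtain ⟨z, hz, hzx⟩ := hpC.symm ▸ mem_univ x
      exact ⟨⟨z, hz⟩, hzx⟩
  let e : C ≃ₜ CompactUniversalCover x₀ :=
    Continuous.homeoOfEquivCompactToT2 (f := Equiv.ofBijective pC hbij) hpCc
  refine ⟨fun x => r (e.symm x).1, hr.comp (continuous_subtype_val.comp e.symm.continuous),
    fun y => ?_, fun x => ?_⟩
  · obtain ⟨z, hz, rfl⟩ := hrC.symm ▸ mem_univ y
    exact ⟨e ⟨z, hz⟩, congrArg (fun w : C => r w.1) (e.symm_apply_apply _)⟩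
  · refine (e.symm x).1.2.symm.trans ?_
    exact congrArg (proj x₀) (e.apply_symm_apply x)

theorem isGeneralizedRegularCovering_of_lift (hf : IsGeneralizedRegularCoveringWith G f)
    {h : CompactUniversalCover x₀ → Y} (hc : Continuous h) (hs : Function.Surjective h)
    (hfh : ∀ x, f (h x) = proj x₀ x) : IsGeneralizedRegularCovering h := by
  let H : Subgroup (Equiv.Perm (CompactUniversalCover x₀)) :=
    { carrier := {γ | Continuous γ ∧ Continuous (γ⁻¹ : Equiv.Perm _) ∧ ∀ x, h (γ x) = h x}
      mul_mem' := fun {a b} ha hb => ⟨ha.1.comp hb.1, hb.2.1.comp ha.2.1,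
        fun x => (ha.2.2 (b x)).trans (hb.2.2 x)⟩
      one_mem' := ⟨continuous_id, continuous_id, fun _ => rfl⟩
      inv_mem' := fun {a} ha => ⟨ha.2.1, ha.1, fun x => by
        rw [← ha.2.2 (a⁻¹ x), perm_apply_inv_self]⟩ }
  have hproj : ∀ {γ}, γ ∈ H → ∀ x, proj x₀ (γ x) = proj x₀ x := fun {γ} hγ x => by
    rw [← hfh, ← hfh, hγ.2.2]
  have hunique : ∀ {γ δ}, γ ∈ H → δ ∈ H → ∀ i t, (γ t).1 i = (δ t).1 i →
      ∀ s, (γ s).1 i = (δ s).1 i := fun {γ δ} hγ hδ i t ht =>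
    eval_lift_unique i ((CompactUniversalCover.continuous_eval i).comp hγ.1)
      ((CompactUniversalCover.continuous_eval i).comp hδ.1)
      (fun t => (hproj hγ t).trans (hproj hδ t).symm) t ht
  have htrans : ∀ a b, h a = h b → ∃ γ : CompactUniversalCover x₀ ≃ₜ CompactUniversalCover x₀,
      h ∘ γ = h ∧ γ a = b := by
    intro a b hab
    obtain ⟨γ, h1, h2⟩ := fiberHomogeneous_proj a b (by rw [← hfh, hab, hfh])
    -- `h ∘ γ` and `h` both lift the projection and agree at `a`, so a homeomorphism over `X` is
    -- automatically one over `Y`.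
    refine ⟨γ, hf.lift_unique (hc.comp γ.continuous) hc (fun t => ?_) a ?_, h2⟩
    · rw [Function.comp_apply, hfh, hfh]
      exact congrFun h1 t
    · rw [Function.comp_apply, h2, hab]
  have hfib : ∀ a b, h a = h b ↔ ∃ γ ∈ H, γ a = b := by
    refine fun a b => ⟨fun hab => ?_, ?_⟩
    · obtain ⟨γ, h1, h2⟩ := htrans a b hab
      exact ⟨γ.toEquiv, ⟨γ.continuous, γ.symm.continuous, congrFun h1⟩, h2⟩
    · rintro ⟨γ, hγ, rfl⟩
      exact (hγ.2.2 a).symm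
  have ho : IsOpenMap h := FiberHomogeneous.isOpenMap hc hs htrans
  have huc : UniformContinuous h := CompactSpace.uniformContinuous_of_continuous hc
  refine ⟨H, ?_, ?_, ?_, ⟨huc, hs, fun E hE => ?_⟩, hfib⟩
  · intro V hV
    obtain ⟨k, W, hW, hWV⟩ := exists_eval_subset hV
    -- All `H`-translates of `W` are intersected. Each `γ` acts on the `k`-th coordinate as a deck
    -- transformation of `X_k`, so finitely many conditions suffice for an entourage.
    let E : Set (CompactUniversalCover x₀ × CompactUniversalCover x₀) :=
      {a | ∀ γ ∈ H, ((γ a.1).1 k, (γ a.2).1 k) ∈ W}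
    refine ⟨E, ?_, fun a ha => hWV (ha 1 H.one_mem), fun g hg => ?_⟩
    · have hfin := k.cover.finite_deck
      have hT : (⋂ d ∈ {d : k.cover.Total ≃ₜ k.cover.Total | k.cover.map ∘ d = k.cover.map},
          {a : k.cover.Total × k.cover.Total | (d a.1, d a.2) ∈ W}) ∈ 𝓤 k.cover.Total :=
        (biInter_mem hfin).2 fun d _ =>
          CompactSpace.uniformContinuous_of_continuous d.continuous hW
      refine mem_of_superset (eval_mem_uniformity k hT) fun a ha γ hγ => ?_
      obtain ⟨d, hd, hd'⟩ := k.isNormalCover.homogeneous (a.1.1 k) ((γ a.1).1 k)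
        (by rw [map_eq_proj, map_eq_proj, hproj hγ])
      have key : (fun x : CompactUniversalCover x₀ => (γ x).1 k) = fun x => d (x.1 k) := by
        refine k.isNormalCover.lift_unique ((CompactUniversalCover.continuous_eval k).comp hγ.1)
          (d.continuous.comp (CompactUniversalCover.continuous_eval k)) (fun t => ?_) a.1 hd'.symm
        rw [map_eq_proj, hproj hγ, ← map_eq_proj t k]
        exact (congrFun hd _).symm
      have h1 : (γ a.1).1 k = d (a.1.1 k) := congrFun key a.1
      have h2 : (γ a.2).1 k = d (a.2.1 k) := congrFun key a.2
      rw [h1, h2]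
      exact mem_iInter₂.1 ha d hd
    · ext ⟨a, b⟩
      constructor
      · rintro ⟨⟨c, d⟩, hcd, e⟩
        rw [← e]
        exact fun γ hγ => hcd (γ * g) (H.mul_mem hγ hg)
      · intro hab
        refine ⟨(g⁻¹ a, g⁻¹ b), fun γ hγ => hab (γ * g⁻¹) (H.mul_mem hγ (H.inv_mem hg)), ?_⟩
        rw [Prod.map_apply, perm_apply_inv_self, perm_apply_inv_self]
  · intro E hE
    obtain ⟨k, W, hW, hWE⟩ := exists_eval_subset hE
    -- In this entourage, closeness within a fiber over `X` means equal `k`-th coordinates. A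
    -- generator thus fixes the `k`-th coordinate of one point, hence of all.
    refine ⟨_, eval_mem_uniformity k
      k.isNormalCover.locallyInjective.separated_mem_uniformity, fun γ hγ => ?_⟩
    have key : γ ∈ H ∧ ∀ x, (γ x).1 k = x.1 k := by
      refine Subgroup.closure_induction (p := fun γ _ => γ ∈ H ∧ ∀ x, (γ x).1 k = x.1 k)
        ?_ ⟨H.one_mem, fun _ => rfl⟩ ?_ ?_ hγ
      · rintro γ ⟨hγ, x, hx⟩
        refine ⟨hγ, hunique hγ H.one_mem k x (Eq.symm (hx ?_))⟩
        change k.cover.map (x.1 k) = k.cover.map ((γ x).1 k)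
        rw [map_eq_proj, map_eq_proj, hproj hγ]
      · rintro γ δ - - ⟨hγ, hγk⟩ ⟨hδ, hδk⟩
        exact ⟨H.mul_mem hγ hδ, fun x => (hγk (δ x)).trans (hδk x)⟩
      · rintro γ - ⟨hγ, hγk⟩
        exact ⟨H.inv_mem hγ, fun x => by rw [← hγk, perm_apply_inv_self]⟩
    refine ⟨key.1, fun x => hWE ?_⟩
    change (x.1 k, (γ x).1 k) ∈ W
    rw [key.2]
    exact refl_mem_uniformity hW
  · let _ := uniformConvergenceUniformity H
    have hind : IsUniformInducing (fun g : H => UniformFun.ofFun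
        (g : Equiv.Perm (CompactUniversalCover x₀))) := ⟨rfl⟩
    rw [completeSpace_iff_isComplete_range hind]
    refine IsClosed.isComplete (isClosed_of_closure_subset fun φ hφ => ?_)
    have happrox : ∀ E ∈ 𝓤 (CompactUniversalCover x₀), ∃ γ ∈ H, ∀ x,
        (UniformFun.toFun φ x, γ x) ∈ E := by
      intro E hE
      obtain ⟨_, h1, γ, rfl⟩ := UniformSpace.mem_closure_iff_ball.1 hφ
        ((UniformFun.hasBasis_uniformity _ _).mem_of_mem hE)
      exact ⟨γ, γ.2, h1⟩
    obtain ⟨x⟩ : Nonempty (CompactUniversalCover x₀) := inferInstance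
    have hh : ∀ x, h (UniformFun.toFun φ x) = h x := by
      refine fun x => eq_of_uniformity fun {V} hV => ?_
      obtain ⟨γ, hγ, hφγ⟩ := happrox _ (huc hV)
      rw [← hγ.2.2 x]
      exact hφγ x
    -- The limit `φ` preserves the fibers of `h`, so some `δ` in `H` agrees with it at `x`. In each
    -- coordinate `φ` equals some `γ` in `H`, and `γ`, `δ` agree there at `x`, hence everywhere.
    obtain ⟨δ, hδ, hδx⟩ := (hfib x (UniformFun.toFun φ x)).1 (hh x).symm
    refine ⟨⟨δ, hδ⟩, UniformFun.toFun.injective (funext fun y => Subtype.ext (funext fun i => ?_))⟩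
    obtain ⟨γ, hγ, hφγ⟩ := happrox _ (eval_mem_uniformity i
      i.isNormalCover.locallyInjective.separated_mem_uniformity)
    have heq : ∀ z, (UniformFun.toFun φ z).1 i = (γ z).1 i := fun z => by
      refine hφγ z ?_
      change i.cover.map ((UniformFun.toFun φ z).1 i) = i.cover.map ((γ z).1 i)
      rw [map_eq_proj, map_eq_proj, hproj hγ, ← hfh, hh, hfh]
    rw [heq]
    exact hunique hδ hγ i x (by rw [hδx, heq]) y
  · rw [compactSpace_uniformity, mem_iSup]
    intro y
    obtain ⟨x, rfl⟩ := hs y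
    exact (ho.prodMap ho).image_mem_nhds (x := (x, x)) (nhds_le_uniformity x hE)

end IsGeneralizedRegularCoveringWith

theorem theorem3 {X : Type u} [UniformSpace X] [CompactSpace X] [ConnectedSpace X]
    [MetrizableSpace X] (x₀ : X)
    {Y : Type v} [UniformSpace Y] [CompactSpace Y] [ConnectedSpace Y] [MetrizableSpace Y]
    (G : Subgroup (Equiv.Perm Y)) (f : Y → X) (hf : IsGeneralizedRegularCoveringWith G f) :
    ∃ fL : CompactUniversalCover x₀ → Y,
      IsGeneralizedRegularCovering fL ∧ CompactUniversalCover.proj x₀ = f ∘ fL ∧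
      ∀ h : CompactUniversalCover x₀ → Y,
        (IsGeneralizedRegularCovering h ∧ CompactUniversalCover.proj x₀ = f ∘ h) ↔
          ∃ g ∈ G, h = g ∘ fL := by
  obtain ⟨fL, hc, hs, hfL⟩ := hf.exists_lift x₀
  refine ⟨fL, hf.isGeneralizedRegularCovering_of_lift hc hs hfL, funext fun x => (hfL x).symm,
    fun h => ⟨?_, ?_⟩⟩
  · rintro ⟨⟨H, hH⟩, hfh⟩
    obtain ⟨x⟩ : Nonempty (CompactUniversalCover x₀) := inferInstance
    have hfh' : ∀ t, f (h t) = f (fL t) := fun t => by rw [hfL, hfh]; rfl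
    -- One point fixes the deck element; unique lifting spreads the equality to all of `X̂`.
    obtain ⟨g, hg, hgx⟩ := (hf.fiber_iff _ _).1 (hfh' x).symm
    refine ⟨g, hg, hf.lift_unique hH.continuous
      ((hf.isomorphic.uniformContinuous hg).continuous.comp hc) (fun t => ?_) x hgx.symm⟩
    rw [Function.comp_apply, hf.map_apply hg, hfh']
  · rintro ⟨g, hg, rfl⟩
    have hgf : ∀ x, f ((g ∘ fL) x) = CompactUniversalCover.proj x₀ x := fun x => by
      rw [Function.comp_apply, hf.map_apply hg, hfL]
    exact ⟨hf.isGeneralizedRegularCovering_of_lift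
      ((hf.isomorphic.uniformContinuous hg).continuous.comp hc) (g.surjective.comp hs) hgf,
      funext fun x => (hgf x).symm⟩
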